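/- Let $a<t<b$, $T=b-a$, and let $m\ge 1$ be an integer. Let $g\in C^\infty[a,b]$ and let $f$ be a (real- or complex-valued) $T$-periodic function that is $C^\infty$ on $\mathbb{R}\setminus\{t+kT: k\in\mathbb{Z}\}$ and satisfies $$f(x)=\frac{g(x)}{(x-t)^m},\qquad x\in[a,b],\ x\ne t.$$ Let $I[f]$ denote the Hadamard finite part of $\int_a^b f(x)\,dx$, that is, the constant term left after the divergent terms (multiples of $\varepsilon^{-k}$, $k\ge1$, and of $\log\varepsilon$) are removed from the expansion of $\int_a^{t-\varepsilon}f(x)\,dx+\int_{t+\varepsilon}^b f(x)\,dx$ as $\varepsilon\to0+$. For $n=1,2,\ldots$ put $$h=\frac{T}{n},\qquad \widetilde T_{m,n}[f]=h\sum_{j=1}^{n-1}f(t+jh).$$ Then $I[f]$ exists, and, with $\zeta$ the Riemann zeta function, the following hold. 1. If $m=2r$ with $r\in\{1,2,\ldots\}$, then for every $\mu>0$, $$\widetilde T_{2r,n}[f]=I[f]+2\sum_{i=0}^{r}\frac{g^{(2i)}(t)}{(2i)!}\,\zeta(2r-2i)\,h^{-2r+2i+1}+o(h^\mu)\qquad\text{as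 } n\to\infty.$$ 2. If $m=2r+1$ with $r\in\{0,1,\ldots\}$, then for every $\mu>0$, $$\widetilde T_{2r+1,n}[f]=I[f]+2\sum_{i=0}^{r}\frac{g^{(2i+1)}(t)}{(2i+1)!}\,\zeta(2r-2i)\,h^{-2r+2i+1}+o(h^\mu)\qquad\text{as } n\to\infty.$$ -/

import Mathlib

open Filter Topology MeasureTheory Asymptotics
open scoped ContDiff

/-- `φ` has finite part `I` at `0+`: for some finite linear combination of the divergent terms
`ε⁻¹, …, ε⁻ᴺ, log ε`, one has `φ ε = (that combination) + I + o(1)` as `ε → 0+`. -/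
def HasFinitePart (φ : ℝ → ℂ) (I : ℂ) : Prop :=
  ∃ (N : ℕ) (c : ℕ → ℂ) (d : ℂ),
    Tendsto (fun ε : ℝ => φ ε - (∑ k ∈ Finset.Icc 1 N, c k * ((ε : ℂ)⁻¹) ^ k
      + d * (Real.log ε : ℂ))) (𝓝[>] 0) (𝓝 I)

/-- `I` is the Hadamard finite part of `∫_a^b f(x) dx`, where `f` is singular at the interior
point `t`: the finite part, as `ε → 0+`, of the ordinary integral of `f` over
`[a, t - ε] ∪ [t + ε, b]`. -/
def IsHadamardFinitePart (f : ℝ → ℂ) (a t b : ℝ) (I : ℂ) : Prop :=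
  (∀ᶠ ε : ℝ in 𝓝[>] 0, IntervalIntegrable f volume a (t - ε) ∧
      IntervalIntegrable f volume (t + ε) b) ∧
    HasFinitePart (fun ε : ℝ => (∫ x in a..(t - ε), f x) + ∫ x in (t + ε)..b, f x) I

/-- A combination of the divergent terms that converges has limit zero. -/
theorem finitePart_gauge_limit (N : ℕ) (c : ℕ → ℂ) (d L : ℂ)
    (h : Tendsto (fun ε : ℝ => ∑ k ∈ Finset.Icc 1 N, c k * ((ε : ℂ)⁻¹) ^ k
      + d * (Real.log ε : ℂ)) (𝓝[>] 0) (𝓝 L)) : L = 0 := by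
  induction N with
  | zero =>
    simp only [Finset.Icc_eq_empty (show ¬ (1 ≤ 0) by omega), Finset.sum_empty, zero_add] at h
    by_cases hd : d = 0
    · subst hd
      simp only [zero_mul] at h
      exact (tendsto_nhds_unique h tendsto_const_nhds)
    · exfalso
      have h1 := (h.const_mul d⁻¹).norm
      have h2 : Tendsto (fun ε : ℝ => ‖Real.log ε‖) (𝓝[>] 0) atTop :=
        tendsto_abs_atBot_atTop.comp Real.tendsto_log_nhdsGT_zero
      refine not_tendsto_nhds_of_tendsto_atTop h2 _ (h1.congr fun ε => ?_)
      rw [← mul_assoc, inv_mul_cancel₀ hd, one_mul, Complex.norm_real]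
  | succ N ih =>
    have hid : Tendsto (fun ε : ℝ => (ε : ℂ)) (𝓝[>] 0) (𝓝 0) := by
      have h0 : Tendsto (fun ε : ℝ => (ε : ℂ)) (𝓝 0) (𝓝 ((0 : ℝ) : ℂ)) :=
        Complex.continuous_ofReal.tendsto 0
      simpa using h0.mono_left nhdsWithin_le_nhds
    have hlog : Tendsto (fun ε : ℝ => (ε : ℂ) ^ (N + 1) * (Real.log ε : ℂ)) (𝓝[>] 0) (𝓝 0) := by
      have h0 := tendsto_log_mul_rpow_nhdsGT_zero (r := (N + 1 : ℕ)) (by positivity)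
      have h1 := (Complex.continuous_ofReal.tendsto 0).comp h0
      simp only [Complex.ofReal_zero] at h1
      refine h1.congr fun ε => ?_
      simp only [Function.comp, Real.rpow_natCast]
      push_cast
      ring
    have hlead : c (N + 1) = 0 := by
      have hA : Tendsto (fun ε : ℝ => (ε : ℂ) ^ (N + 1) *
          (∑ k ∈ Finset.Icc 1 (N + 1), c k * ((ε : ℂ)⁻¹) ^ k + d * (Real.log ε : ℂ)))
          (𝓝[>] 0) (𝓝 0) := by
        have := (hid.pow (N + 1)).mul h
        simpa using this
      have hB : Tendsto (fun ε : ℝ => (∑ k ∈ Finset.Icc 1 N, c k * (ε : ℂ) ^ (N + 1 - k))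
          + c (N + 1) + d * ((ε : ℂ) ^ (N + 1) * (Real.log ε : ℂ)))
          (𝓝[>] 0) (𝓝 (0 + c (N + 1) + d * 0)) := by
        refine (Tendsto.add ?_ tendsto_const_nhds).add (hlog.const_mul d)
        have : Tendsto (fun ε : ℝ => ∑ k ∈ Finset.Icc 1 N, c k * (ε : ℂ) ^ (N + 1 - k))
            (𝓝[>] 0) (𝓝 (∑ k ∈ Finset.Icc 1 N, (0 : ℂ))) := by
          refine tendsto_finsetSum _ fun k hk => ?_
          have hk' : N + 1 - k ≠ 0 := by
            have := Finset.mem_Icc.1 hk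
            omega
          have := (hid.pow (N + 1 - k)).const_mul (c k)
          simpa [hk'] using this
        simpa using this
      have hC := tendsto_nhds_unique (hA.congr' ?_) hB
      · simpa using hC.symm
      · filter_upwards [self_mem_nhdsWithin] with ε hε
        have hε' : (ε : ℂ) ≠ 0 := by
          exact_mod_cast (ne_of_gt hε)
        rw [Finset.sum_Icc_succ_top (by omega), mul_add, mul_add, Finset.mul_sum]
        congr 1
        · congr 1
          · refine Finset.sum_congr rfl fun k hk => ?_
            have hk' : k ≤ N + 1 := by
              have := Finset.mem_Icc.1 hk
              omega
            rw [pow_sub₀ _ hε' hk', inv_pow]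
            ring
          · rw [inv_pow]
            field_simp
        · ring
    apply ih
    refine h.congr fun ε => ?_
    rw [Finset.sum_Icc_succ_top (by omega), hlead, zero_mul, add_zero]

/-- The finite part is unique. -/
theorem HasFinitePart.unique {φ : ℝ → ℂ} {I J : ℂ} (hI : HasFinitePart φ I)
    (hJ : HasFinitePart φ J) : I = J := by
  obtain ⟨N, c, d, h⟩ := hI
  obtain ⟨M, c', d', h'⟩ := hJ
  have key := finitePart_gauge_limit (max N M)
    (fun k => (if k ≤ M then c' k else 0) - (if k ≤ N then c k else 0)) (d' - d) (I - J)
    ((h.sub h').congr fun ε => ?_)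
  · exact sub_eq_zero.1 key
  · have e : ∀ (K : ℕ) (u : ℕ → ℂ), K ≤ max N M →
        ∑ k ∈ Finset.Icc 1 (max N M), (if k ≤ K then u k else 0) * ((ε : ℂ)⁻¹) ^ k
          = ∑ k ∈ Finset.Icc 1 K, u k * ((ε : ℂ)⁻¹) ^ k := by
      intro K u hK
      simp only [ite_mul, zero_mul]
      rw [← Finset.sum_filter]
      refine Finset.sum_congr ?_ fun _ _ => rfl
      ext k
      simp only [Finset.mem_filter, Finset.mem_Icc]
      omega
    simp only [sub_mul, Finset.sum_sub_distrib]
    rw [e M c' (le_max_right _ _), e N c (le_max_left _ _)]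
    ring

theorem IsHadamardFinitePart.unique {f : ℝ → ℂ} {a t b : ℝ} {I J : ℂ}
    (hI : IsHadamardFinitePart f a t b I) (hJ : IsHadamardFinitePart f a t b J) : I = J :=
  hI.2.unique hJ.2

open Classical in
/-- The Hadamard finite part of `∫_a^b f(x) dx` with singular point `t` (zero if it does not
exist). -/
noncomputable def hadamardFinitePart (f : ℝ → ℂ) (a t b : ℝ) : ℂ :=
  if h : ∃ I, IsHadamardFinitePart f a t b I then h.choose else 0

/-- The real line without the points `t + k T`, `k ∈ ℤ`. -/
def puncturedLine (t T : ℝ) : Set ℝ := {x | ∀ k : ℤ, x ≠ t + k * T}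

/-- The sum `h ∑_{j=1}^{n-1} f(t + j h)` with `h = T / n`. -/
noncomputable def trapezoidalSum (f : ℝ → ℂ) (t T : ℝ) (n : ℕ) : ℂ :=
  ((T / n : ℝ) : ℂ) * ∑ j ∈ Finset.Ico 1 n, f (t + j * (T / n))

/-!
The expansion is exact up to the error of the trapezoidal rule for a smooth periodic function.
Translate so that the singularity sits at `0`, and write `F u = f (t + u)`.

The case `m = 2r + 1` is the case of the even order `2r + 2` with `g` replaced by `(x - t) g`, whose
Taylor coefficients are those of `g` shifted by one, so only `m = 2r` needs an argument. Both the
trapezoidal sum and the truncated integrals are invariant under `u ↦ -u`, so only the even part of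
`F` matters; its singular part at `0` is `∑_{i < r} c_{2i} u^{2i - 2r}`, where `c_k` are the Taylor
coefficients of `g` at `t`.

Each even power `u⁻ᵏ`, `k ≥ 2`, is the singular part of the `T`-periodic function
`Φ_k(u) = ∑_{l ∈ ℤ} (u + l T)⁻ᵏ` (`latticeSum`), for which everything is explicit:
* its trapezoidal sum rearranges into one sum over `ℤ`, giving `2 ζ(k) h^{1 - k}`
  (`sum_latticeSum`);
* the finite part of its integral over a period is `0`, by a telescoping sum
  (`tendsto_integral_latticeSum`).

Subtracting `∑_{i < r} c_{2i} Φ_{2r - 2i}` from the even part of `F` leaves a function `q` that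
extends to a smooth `T`-periodic function (`exists_regularPart`); its value at `0` contributes
`c_{2r} h = -2 c_{2r} ζ(0) h`, the last term of the expansion. What remains is that trapezoidal sums
of a smooth periodic function converge to the integral faster than any power of `h`
(`norm_trapezoid_sub_integral_le`): as a function of the offset, the trapezoidal sum of `q` has mean
`∫ q` over a cell of length `h`, while its derivative is the trapezoidal sum of `q'`, whose integral
vanishes; so each induction step gains a factor `h`.
-/

/-! ### The trapezoidal rule for smooth periodic functions -/

theorem Function.Periodic.exists_norm_le {E : Type*} [SeminormedAddCommGroup E] {q : ℝ → E}
    {T : ℝ} (hq : Function.Periodic q T) (hc : Continuous q) (hT : 0 < T) :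
    ∃ M, ∀ x, ‖q x‖ ≤ M := by
  obtain ⟨M, hM⟩ := isCompact_Icc (a := (0 : ℝ)) (b := T) |>.exists_bound_of_continuousOn
    hc.continuousOn
  refine ⟨M, fun x => ?_⟩
  obtain ⟨y, hy, hxy⟩ := hq.exists_mem_Ico₀ hT x
  rw [hxy]
  exact hM y (Set.Ico_subset_Icc_self hy)

theorem Function.Periodic.deriv_periodic {q : ℝ → ℂ} {T : ℝ} (hq : Function.Periodic q T) :
    Function.Periodic (deriv q) T := by
  intro x
  rw [← deriv_comp_add_const]
  congr 1
  exact funext hq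

/-- Integrating a sum of `n` equally spaced samples over one cell gives the integral over a
period. -/
theorem integral_shifted_sum {T : ℝ} {q : ℝ → ℂ} (hc : Continuous q)
    (hq : Function.Periodic q T) {n : ℕ} (hn : 1 ≤ n) (x : ℝ) :
    ∫ y in x..(x + T / n), ∑ j ∈ Finset.range n, q (y + j * (T / n)) = ∫ y in (0 : ℝ)..T, q y := by
  have hn0 : (n : ℝ) ≠ 0 := by positivity
  rw [intervalIntegral.integral_finsetSum
    (fun j _ => Continuous.intervalIntegrable (by fun_prop) _ _)]
  have := intervalIntegral.sum_integral_adjacent_intervals (f := q) (μ := volume)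
    (a := fun j : ℕ => x + j * (T / n)) (n := n) (fun k _ => hc.intervalIntegrable _ _)
  have hI := hq.intervalIntegral_add_eq x 0
  rw [zero_add] at hI
  rw [← hI]
  simp only [intervalIntegral.integral_comp_add_right]
  have e : x + ((n : ℕ) : ℝ) * (T / n) = x + T := by field_simp
  rw [e] at this
  simp only [Nat.cast_zero, zero_mul, add_zero] at this
  rw [← this]
  refine Finset.sum_congr rfl fun j _ => ?_
  congr 1
  push_cast
  ring

/-- The trapezoidal rule for a smooth periodic function has error `O(h ^ N)` for every `N`, uniformly
in the offset `x`. Uniformity in `x` is what lets the bound for `q'` control the oscillation of the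
trapezoidal sum of `q`. -/
theorem norm_trapezoid_sub_integral_le {T : ℝ} (hT : 0 < T) (N : ℕ) : ∀ q : ℝ → ℂ,
    ContDiff ℝ ∞ q → Function.Periodic q T → ∃ C : ℝ, ∀ n : ℕ, 1 ≤ n → ∀ x : ℝ,
      ‖((T / n : ℝ) : ℂ) * ∑ j ∈ Finset.range n, q (x + j * (T / n)) - ∫ y in (0 : ℝ)..T, q y‖
        ≤ C * (T / n) ^ N := by
  induction N with
  | zero =>
    intro q hq hper
    obtain ⟨M, hM⟩ := hper.exists_norm_le hq.continuous hT
    refine ⟨T * M + ‖∫ y in (0 : ℝ)..T, q y‖, fun n hn x => ?_⟩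
    have hn0 : (n : ℝ) ≠ 0 := by positivity
    rw [pow_zero, mul_one]
    refine (norm_sub_le _ _).trans (add_le_add_left ?_ _)
    rw [norm_mul, Complex.norm_real, Real.norm_of_nonneg (by positivity)]
    calc T / n * ‖∑ j ∈ Finset.range n, q (x + j * (T / n))‖
        ≤ T / n * ∑ j ∈ Finset.range n, M := by
          gcongr
          exact norm_sum_le_of_le _ fun j _ => hM _
      _ = T * M := by
          rw [Finset.sum_const, Finset.card_range, nsmul_eq_mul]; field_simp
  | succ N ih =>
    intro q hq hper
    have hq' : ContDiff ℝ ∞ (deriv q) := (contDiff_infty_iff_deriv.1 hq).2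
    have hd : Differentiable ℝ q := (contDiff_infty_iff_deriv.1 hq).1
    obtain ⟨C, hC⟩ := ih (deriv q) hq' hper.deriv_periodic
    have hC0 : 0 ≤ C := by
      have := (norm_nonneg _).trans (hC 1 le_rfl 0)
      have h2 : 0 < (T / (1 : ℕ)) ^ N := by positivity
      exact nonneg_of_mul_nonneg_left this h2
    refine ⟨C, fun n hn x => ?_⟩
    have hn0 : (0 : ℝ) < n := by exact_mod_cast hn
    set h := T / n with hh
    have hh0 : 0 < h := by positivity
    set S : ℝ → ℂ := fun y => (h : ℂ) * ∑ j ∈ Finset.range n, q (y + j * h) with hS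
    have hderiv : ∀ y, HasDerivAt S ((h : ℂ) * ∑ j ∈ Finset.range n, deriv q (y + j * h)) y := by
      intro y
      refine HasDerivAt.const_mul _ (HasDerivAt.fun_sum fun j _ => ?_)
      exact (hd _).hasDerivAt.comp_add_const y (j * h)
    have hint : ∫ y in (0 : ℝ)..T, deriv q y = 0 := by
      rw [intervalIntegral.integral_deriv_eq_sub (fun y _ => hd y)
        (hq'.continuous.intervalIntegrable _ _)]
      have := hper 0
      rw [zero_add] at this
      rw [this, sub_self]
    have hlip : ∀ y z, ‖S z - S y‖ ≤ C * h ^ N * ‖z - y‖ := fun y z =>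
      convex_univ.norm_image_sub_le_of_norm_hasDerivWithin_le
        (fun w _ => (hderiv w).hasDerivWithinAt)
        (fun w _ => by simpa only [hint, sub_zero] using hC n hn w) (Set.mem_univ y) (Set.mem_univ z)
    have hScont : Continuous S := continuous_iff_continuousAt.2 fun y => (hderiv y).continuousAt
    -- The offset sum `S` has mean `∫ q` over each cell, and it varies by at most `C h ^ N * h` there.
    have hmean : ∫ y in x..(x + h), S y = h * ∫ y in (0 : ℝ)..T, q y := by
      rw [hS, intervalIntegral.integral_const_mul, integral_shifted_sum hq.continuous hper hn]
    have hdiff : (h : ℂ) * (S x - ∫ y in (0 : ℝ)..T, q y) = ∫ y in x..(x + h), (S x - S y) := by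
      rw [intervalIntegral.integral_sub (by simp) (hScont.intervalIntegrable _ _), hmean,
        intervalIntegral.integral_const, add_sub_cancel_left, Complex.real_smul]
      ring
    have hbound : ‖∫ y in x..(x + h), (S x - S y)‖ ≤ C * h ^ N * h * |x + h - x| := by
      refine intervalIntegral.norm_integral_le_of_norm_le_const fun y hy => ?_
      rw [Set.uIoc_of_le (by linarith)] at hy
      refine (hlip y x).trans ?_
      gcongr
      rw [Real.norm_eq_abs, abs_le]
      constructor <;> linarith [hy.1, hy.2]
    rw [← hdiff, norm_mul, Complex.norm_real, Real.norm_of_nonneg hh0.le, add_sub_cancel_left,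
      abs_of_pos hh0, mul_comm h] at hbound
    have := le_of_mul_le_mul_right hbound hh0
    rwa [mul_assoc, ← pow_succ] at this

/-! ### Smooth division by powers of the variable -/

theorem hasDerivAt_integral_pow_mul_comp_mul {f : ℝ → ℂ} (hf : ContDiff ℝ 1 f) (k : ℕ) (u : ℝ) :
    HasDerivAt (fun u : ℝ => ∫ s in (0 : ℝ)..1, (s : ℂ) ^ k * f (s * u))
      (∫ s in (0 : ℝ)..1, (s : ℂ) ^ (k + 1) * deriv f (s * u)) u := by
  have hc : Continuous f := hf.continuous
  have hc' : Continuous (deriv f) := hf.continuous_deriv le_rfl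
  have hd : Differentiable ℝ f := hf.differentiable one_ne_zero
  obtain ⟨M, hM⟩ := ((isCompact_Icc (a := (0 : ℝ)) (b := 1)).prod
    (isCompact_Icc (a := u - 1) (b := u + 1))).exists_bound_of_continuousOn
    (f := fun p : ℝ × ℝ => (p.1 : ℂ) ^ (k + 1) * deriv f (p.1 * p.2)) (by fun_prop)
  refine (intervalIntegral.hasDerivAt_integral_of_dominated_loc_of_deriv_le
    (F' := fun u s => (s : ℂ) ^ (k + 1) * deriv f (s * u)) (bound := fun _ => M)
    (Icc_mem_nhds (show u - 1 < u by linarith) (show u < u + 1 by linarith)) ?_ ?_ ?_ ?_ ?_ ?_).2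
  · exact Eventually.of_forall fun x => Continuous.aestronglyMeasurable (by fun_prop)
  · exact Continuous.intervalIntegrable (by fun_prop) _ _
  · exact Continuous.aestronglyMeasurable (by fun_prop)
  · refine Eventually.of_forall fun s hs x hx => hM (s, x) ⟨?_, hx⟩
    rw [Set.uIoc_of_le zero_le_one] at hs
    exact Set.Ioc_subset_Icc_self hs
  · simp
  · refine Eventually.of_forall fun s _ x _ => ?_
    have h1 : HasDerivAt (fun x : ℝ => s * x) s x := by simpa using (hasDerivAt_id x).const_mul s
    have h2 := ((hd (s * x)).hasDerivAt.scomp x h1).const_mul ((s : ℂ) ^ k)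
    refine h2.congr_deriv ?_
    rw [Complex.real_smul]
    ring

/-- Powers of `s` are allowed in the integrand because each differentiation in `u`
produces one more. -/
theorem contDiff_integral_pow_mul_comp_mul (n : ℕ) : ∀ (k : ℕ) {f : ℝ → ℂ}, ContDiff ℝ ∞ f →
    ContDiff ℝ n (fun u : ℝ => ∫ s in (0 : ℝ)..1, (s : ℂ) ^ k * f (s * u)) := by
  induction n with
  | zero =>
    intro k f hf
    rw [Nat.cast_zero, contDiff_zero]
    exact continuous_iff_continuousAt.2 fun u =>
      (hasDerivAt_integral_pow_mul_comp_mul (hf.of_le (by simp)) k u).continuousAt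
  | succ n ih =>
    intro k f hf
    have hderiv := fun u => hasDerivAt_integral_pow_mul_comp_mul (hf.of_le (by simp)) k u
    rw [Nat.cast_add, Nat.cast_one, contDiff_succ_iff_deriv]
    refine ⟨fun u => (hderiv u).differentiableAt, by simp, ?_⟩
    rw [funext fun u => (hderiv u).deriv]
    exact ih (k + 1) (contDiff_infty_iff_deriv.1 hf).2

/-- Hadamard's lemma: the quotient is `∫₀¹ G'(s u) ds`. -/
theorem exists_contDiff_eq_add_mul {G : ℝ → ℂ} (hG : ContDiff ℝ ∞ G) :
    ∃ H : ℝ → ℂ, ContDiff ℝ ∞ H ∧ ∀ u : ℝ, G u = G 0 + u * H u := by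
  refine ⟨fun u => ∫ s in (0 : ℝ)..1, (s : ℂ) ^ 0 * deriv G (s * u), ?_, fun u => ?_⟩
  · exact contDiff_infty.2 fun n =>
      contDiff_integral_pow_mul_comp_mul n 0 (contDiff_infty_iff_deriv.1 hG).2
  · have hd := (contDiff_infty_iff_deriv.1 hG).1
    have hc := (contDiff_infty_iff_deriv.1 hG).2.continuous
    have h : ∀ s ∈ Set.uIcc (0 : ℝ) 1,
        HasDerivAt (fun s : ℝ => G (s * u)) (u * ((s : ℂ) ^ 0 * deriv G (s * u))) s := by
      intro s _
      have h1 : HasDerivAt (fun s : ℝ => s * u) u s := by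
        simpa using (hasDerivAt_id s).mul_const u
      refine ((hd (s * u)).hasDerivAt.scomp s h1).congr_deriv ?_
      rw [Complex.real_smul, pow_zero, one_mul]
    have := intervalIntegral.integral_eq_sub_of_hasDerivAt h
      (Continuous.intervalIntegrable (by fun_prop) _ _)
    rw [intervalIntegral.integral_const_mul] at this
    rw [this]
    simp

theorem iteratedDeriv_succ_ofReal_mul {H : ℝ → ℂ} {u : ℝ} (k : ℕ)
    (hH : ContDiffAt ℝ (k + 1 : ℕ) H u) :
    iteratedDeriv (k + 1) (fun u : ℝ => (u : ℂ) * H u) u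
      = u * iteratedDeriv (k + 1) H u + (k + 1) * iteratedDeriv k H u := by
  have hid : ∀ i : ℕ, iteratedDeriv i (fun u : ℝ => (u : ℂ)) u
      = if i = 0 then (u : ℂ) else if i = 1 then 1 else 0 := by
    have hd : deriv (fun u : ℝ => (u : ℂ)) = fun _ => 1 :=
      funext fun x => Complex.ofRealCLM.hasDerivAt.deriv
    intro i
    rcases i with _ | _ | i
    · simp
    · simp [iteratedDeriv_one, hd]
    · rw [iteratedDeriv_succ', hd]
      simp [iteratedDeriv_const]
  have hof : ContDiffAt ℝ (k + 1 : ℕ) (fun u : ℝ => (u : ℂ)) u :=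
    Complex.ofRealCLM.contDiff.contDiffAt
  rw [iteratedDeriv_fun_mul hof hH]
  rw [Finset.sum_range_succ', Finset.sum_range_succ', Finset.sum_eq_zero]
  · simp [hid]
    ring
  · intro i _
    simp [hid]

theorem iteratedDeriv_succ_ofReal_mul_div_factorial {G : ℝ → ℂ} (hG : ContDiff ℝ ∞ G) (k : ℕ) :
    iteratedDeriv (k + 1) (fun u : ℝ => (u : ℂ) * G u) 0 / ((k + 1).factorial : ℂ)
      = iteratedDeriv k G 0 / (k.factorial : ℂ) := by
  rw [iteratedDeriv_succ_ofReal_mul k (hG.contDiffAt.of_le (by exact_mod_cast le_top)),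
    Nat.factorial_succ]
  have : ((k : ℂ) + 1) ≠ 0 := by exact_mod_cast k.succ_ne_zero
  have : (k.factorial : ℂ) ≠ 0 := by exact_mod_cast k.factorial_ne_zero
  push_cast
  field_simp
  ring

/-- Taylor expansion with a smooth remainder factor, whose value at `0` is the next Taylor
coefficient. -/
theorem exists_contDiff_taylor (n : ℕ) {G : ℝ → ℂ} (hG : ContDiff ℝ ∞ G) :
    ∃ H : ℝ → ℂ, ContDiff ℝ ∞ H ∧ H 0 = iteratedDeriv n G 0 / (n.factorial : ℂ) ∧
      ∀ u : ℝ, G u = ∑ k ∈ Finset.range n, iteratedDeriv k G 0 / (k.factorial : ℂ) * (u : ℂ) ^ k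
        + u ^ n * H u := by
  induction n generalizing G with
  | zero => exact ⟨G, hG, by simp, fun u => by simp⟩
  | succ n ih =>
    obtain ⟨G₁, hG₁, hGG₁⟩ := exists_contDiff_eq_add_mul hG
    have hcoef : ∀ k : ℕ, iteratedDeriv (k + 1) G 0 / ((k + 1).factorial : ℂ)
        = iteratedDeriv k G₁ 0 / (k.factorial : ℂ) := by
      intro k
      rw [funext hGG₁, iteratedDeriv_const_add (by omega),
        iteratedDeriv_succ_ofReal_mul_div_factorial hG₁]
    obtain ⟨H, hH, hH0, hHG⟩ := ih hG₁
    refine ⟨H, hH, by rw [hH0, hcoef], fun u => ?_⟩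
    rw [hGG₁ u, hHG u, Finset.sum_range_succ']
    simp only [hcoef]
    rw [mul_add, Finset.mul_sum]
    simp only [iteratedDeriv_zero, Nat.factorial_zero, Nat.cast_one, div_one, pow_zero, mul_one]
    have hsum : ∑ k ∈ Finset.range n,
        (u : ℂ) * (iteratedDeriv k G₁ 0 / (k.factorial : ℂ) * (u : ℂ) ^ k)
        = ∑ k ∈ Finset.range n, iteratedDeriv k G₁ 0 / (k.factorial : ℂ) * (u : ℂ) ^ (k + 1) :=
      Finset.sum_congr rfl fun k _ => by ring
    rw [hsum]
    ring

/-- The germ of a smooth function extends to a smooth function on the line. -/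
theorem exists_contDiff_eventuallyEq {g : ℝ → ℂ} {s : Set ℝ} {t : ℝ} (hs : s ∈ 𝓝 t)
    (hg : ContDiffOn ℝ ∞ g s) : ∃ G : ℝ → ℂ, ContDiff ℝ ∞ G ∧ G =ᶠ[𝓝 t] g := by
  obtain ⟨δ, hδ, hball⟩ := Metric.mem_nhds_iff.1 hs
  let b : ContDiffBump t := ⟨δ / 3, δ / 2, by positivity, by linarith⟩
  refine ⟨fun x => b x • g x, ?_, ?_⟩
  · rw [contDiff_iff_contDiffAt]
    intro x
    by_cases hx : x ∈ Metric.ball t δ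
    · exact b.contDiff.contDiffAt.smul ((hg.mono hball).contDiffAt (Metric.isOpen_ball.mem_nhds hx))
    · have : x ∈ (tsupport b)ᶜ := by
        rw [b.tsupport_eq]
        intro h
        apply hx
        rw [Metric.mem_closedBall] at h
        rw [Metric.mem_ball]
        have : b.rOut = δ / 2 := rfl
        linarith
      have h0 : (fun x => b x • g x) =ᶠ[𝓝 x] fun _ => 0 := by
        filter_upwards [(isClosed_tsupport b).isOpen_compl.mem_nhds this] with y hy
        rw [image_eq_zero_of_notMem_tsupport hy, zero_smul]
      exact contDiffAt_const.congr_of_eventuallyEq h0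
  · filter_upwards [b.eventuallyEq_one] with x hx
    rw [hx]
    simp

/-! ### Periodic lattice sums -/

/-- The `T`-periodic sum `∑_{l ∈ ℤ} (z + l T)⁻ᵏ`. At `z ∈ T ℤ` the singular term is `0⁻¹ = 0`, so the
value there is that of the sum over the remaining terms. -/
noncomputable def latticeSum (T : ℝ) (k : ℕ) (z : ℂ) : ℂ :=
  ∑' l : ℤ, ((z + l * T) ^ k)⁻¹

/-- The sum `∑_{l ≠ 0} (z + l T)⁻ᵏ`, the regular part of `latticeSum T k` at the origin. -/
noncomputable def puncturedLatticeSum (T : ℝ) (k : ℕ) (z : ℂ) : ℂ :=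
  ∑' l : ℤ, if l = 0 then 0 else ((z + l * T) ^ k)⁻¹

theorem norm_puncturedLatticeSum_term_le {T c : ℝ} (hc : c < T) (hT : 0 < T) (k : ℕ) {z : ℂ}
    (hz : ‖z‖ ≤ c) (l : ℤ) :
    ‖if l = 0 then 0 else ((z + l * T) ^ k)⁻¹‖ ≤ ((T - c) ^ k)⁻¹ * |1 / (l : ℝ) ^ k| := by
  split_ifs with hl
  · rw [norm_zero]
    have : 0 < T - c := by linarith
    positivity
  · have hl1 : (1 : ℝ) ≤ |(l : ℝ)| := by exact_mod_cast Int.one_le_abs hl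
    have h1 : |(l : ℝ)| * (T - c) ≤ ‖z + l * T‖ := by
      have h2 : ‖(l : ℂ) * T‖ - ‖z‖ ≤ ‖z + l * T‖ := by
        rw [add_comm]
        exact norm_sub_le_norm_add _ _
      have h3 : ‖(l : ℂ) * T‖ = |(l : ℝ)| * T := by
        rw [norm_mul, Complex.norm_intCast, Complex.norm_real, Real.norm_of_nonneg hT.le]
      have h4 : c ≤ |(l : ℝ)| * c := le_mul_of_one_le_left ((norm_nonneg z).trans hz) hl1
      rw [mul_sub]
      linarith
    have h0 : 0 < |(l : ℝ)| * (T - c) := mul_pos (by linarith) (by linarith)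
    rw [norm_inv, norm_pow, abs_div, abs_one, abs_pow, one_div, ← mul_inv, ← mul_pow,
      mul_comm (T - c)]
    gcongr

theorem summable_puncturedLatticeSum_bound {k : ℕ} (hk : 2 ≤ k) (C : ℝ) :
    Summable fun l : ℤ => C * |1 / (l : ℝ) ^ k| :=
  (Real.summable_one_div_int_pow.2 hk).abs.mul_left C

theorem summable_puncturedLatticeSum {T : ℝ} (hT : 0 < T) {k : ℕ} (hk : 2 ≤ k) {z : ℂ}
    (hz : ‖z‖ < T) : Summable fun l : ℤ => if l = 0 then 0 else ((z + l * T) ^ k)⁻¹ :=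
  .of_norm_bounded (summable_puncturedLatticeSum_bound hk _)
    (norm_puncturedLatticeSum_term_le hz hT k le_rfl)

/-- This holds at `z = 0` too, since there both `latticeSum` and `(z ^ k)⁻¹` drop the singular term. -/
theorem latticeSum_eq_add_punctured {T : ℝ} (hT : 0 < T) {k : ℕ} (hk : 2 ≤ k) {z : ℂ}
    (hz : ‖z‖ < T) : latticeSum T k z = (z ^ k)⁻¹ + puncturedLatticeSum T k z := by
  have hs : Summable fun l : ℤ => ((z + l * T) ^ k)⁻¹ := by
    refine (summable_puncturedLatticeSum hT hk hz).congr_cofinite ?_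
    filter_upwards [(Set.finite_singleton (0 : ℤ)).compl_mem_cofinite] with l hl
    exact if_neg hl
  rw [latticeSum, puncturedLatticeSum, hs.tsum_eq_add_tsum_ite 0]
  simp

/-- The sum is holomorphic in the disc `|z| < T` by locally uniform convergence. -/
theorem contDiffAt_puncturedLatticeSum {T : ℝ} {k : ℕ} (hk : 2 ≤ k) {u : ℝ}
    (hu : |u| < T) : ContDiffAt ℝ ∞ (fun u : ℝ => puncturedLatticeSum T k u) u := by
  have hT : 0 < T := (abs_nonneg u).trans_lt hu
  obtain ⟨c, huc, hc⟩ := exists_between hu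
  have hd : DifferentiableOn ℂ (puncturedLatticeSum T k) (Metric.ball 0 c) := by
    refine Complex.differentiableOn_tsum_of_summable_norm
      (summable_puncturedLatticeSum_bound hk ((T - c) ^ k)⁻¹) (fun l => ?_) Metric.isOpen_ball
      (fun l w hw => norm_puncturedLatticeSum_term_le hc hT k (mem_ball_zero_iff.1 hw).le l)
    by_cases hl : l = 0
    · simp [hl]
    · simp only [hl, if_false]
      intro w hw
      refine DifferentiableAt.differentiableWithinAt (DifferentiableAt.inv (by fun_prop) ?_)
      refine pow_ne_zero _ fun h => ?_
      have hw' := mem_ball_zero_iff.1 hw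
      rw [eq_neg_of_add_eq_zero_left h, norm_neg, norm_mul, Complex.norm_intCast,
        Complex.norm_real, Real.norm_of_nonneg hT.le] at hw'
      have hl1 : (1 : ℝ) ≤ |(l : ℝ)| := by exact_mod_cast Int.one_le_abs hl
      nlinarith
  have hmem : (u : ℂ) ∈ Metric.ball (0 : ℂ) c := by
    rw [mem_ball_zero_iff, Complex.norm_real]
    exact huc
  have h1 : ContDiffAt ℂ ∞ (puncturedLatticeSum T k) u :=
    (hd.contDiffOn Metric.isOpen_ball).contDiffAt (Metric.isOpen_ball.mem_nhds hmem)
  exact (h1.restrict_scalars ℝ).comp u Complex.ofRealCLM.contDiff.contDiffAt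

theorem latticeSum_add_period (T : ℝ) (k : ℕ) (z : ℂ) :
    latticeSum T k (z + T) = latticeSum T k z := by
  rw [latticeSum, latticeSum,
    ← (Equiv.addRight (1 : ℤ)).tsum_eq (fun l : ℤ => ((z + l * T) ^ k)⁻¹)]
  refine tsum_congr fun l => ?_
  rw [Equiv.coe_addRight]
  push_cast
  ring_nf

theorem latticeSum_neg (T : ℝ) {k : ℕ} (hk : Even k) (z : ℂ) :
    latticeSum T k (-z) = latticeSum T k z := by
  rw [latticeSum, latticeSum, ← (Equiv.neg ℤ).tsum_eq]
  refine tsum_congr fun l => ?_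
  rw [Equiv.neg_apply, Int.cast_neg, neg_mul, ← neg_add, hk.neg_pow]

theorem puncturedLatticeSum_neg (T : ℝ) {k : ℕ} (hk : Even k) (z : ℂ) :
    puncturedLatticeSum T k (-z) = puncturedLatticeSum T k z := by
  rw [puncturedLatticeSum, puncturedLatticeSum, ← (Equiv.neg ℤ).tsum_eq]
  refine tsum_congr fun l => ?_
  rw [Equiv.neg_apply, Int.cast_neg, neg_mul, ← neg_add, hk.neg_pow]
  simp

/-- The points `j h + l T`, for `0 ≤ j < n` and `l ∈ ℤ`, are the multiples of `h`, so the double sum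
is `∑_{N ≠ 0} (N h)⁻ᵏ`. -/
theorem sum_latticeSum (T : ℝ) {k : ℕ} (hk : 2 ≤ k) (hk2 : Even k) {n : ℕ} (hn : 1 ≤ n) :
    ∑ j ∈ Finset.range n, latticeSum T k ((j * (T / n) : ℝ) : ℂ)
      = 2 * riemannZeta k * (((T / n : ℝ) : ℂ) ^ k)⁻¹ := by
  have : NeZero n := ⟨by omega⟩
  have hn0 : (n : ℂ) ≠ 0 := by exact_mod_cast (by omega : n ≠ 0)
  rw [two_mul_riemannZeta_eq_tsum_int_inv_pow_of_even hk hk2, ← tsum_mul_right]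
  have hs : Summable fun N : ℤ => ((N : ℂ) ^ k)⁻¹ * (((T / n : ℝ) : ℂ) ^ k)⁻¹ := by
    refine Summable.mul_right _ (Summable.of_norm ?_)
    refine (Real.summable_one_div_int_pow.2 hk).abs.congr fun N => ?_
    rw [norm_inv, norm_pow, Complex.norm_intCast, abs_div, abs_one, one_div, abs_pow]
  have hs' := (((Equiv.prodComm _ _).trans (Int.divModEquiv n).symm).summable_iff
    (f := fun N : ℤ => ((N : ℂ) ^ k)⁻¹ * (((T / n : ℝ) : ℂ) ^ k)⁻¹)).2 hs
  -- Write `N = l n + j` with `0 ≤ j < n`.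
  rw [← ((Equiv.prodComm _ _).trans (Int.divModEquiv n).symm).tsum_eq]
  refine Eq.trans ?_ hs'.tsum_prod.symm
  rw [tsum_fintype, ← Fin.sum_univ_eq_sum_range (fun j => latticeSum T k ((j * (T / n) : ℝ) : ℂ))]
  refine Finset.sum_congr rfl fun j _ => ?_
  rw [latticeSum]
  refine tsum_congr fun l => ?_
  simp only [Function.comp, Equiv.trans_apply, Equiv.prodComm_apply, Prod.swap_prod_mk,
    Int.divModEquiv, Equiv.coe_fn_symm_mk]
  rw [← mul_inv, ← mul_pow]
  push_cast
  congr 2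
  field_simp
  ring

theorem integral_inv_add_pow {k : ℕ} (hk : 2 ≤ k) {a b c : ℝ}
    (h : (0 : ℝ) ∉ Set.uIcc (a + c) (b + c)) :
    ∫ u in a..b, (((u : ℂ) + c) ^ k)⁻¹
      = ((((a + c) ^ (k - 1))⁻¹ / (k - 1) - ((b + c) ^ (k - 1))⁻¹ / (k - 1) : ℝ) : ℂ) := by
  have e : ∀ u : ℝ, (((u : ℂ) + c) ^ k)⁻¹ = (((u + c) ^ (-(k : ℤ)) : ℝ) : ℂ) := by
    intro u
    rw [zpow_neg, zpow_natCast]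
    push_cast
    rfl
  simp only [e]
  rw [intervalIntegral.integral_ofReal,
    intervalIntegral.integral_comp_add_right (fun x : ℝ => x ^ (-(k : ℤ))),
    integral_zpow (Or.inr ⟨by omega, h⟩)]
  have e1 : -(k : ℤ) + 1 = -((k - 1 : ℕ) : ℤ) := by omega
  rw [e1, zpow_neg, zpow_natCast, zpow_neg, zpow_natCast]
  congr 1
  have hk1 : (k : ℝ) - 1 ≠ 0 := by
    have : (2 : ℝ) ≤ k := by exact_mod_cast hk
    linarith
  have e2 : ((-(k : ℤ) : ℤ) : ℝ) + 1 = -((k : ℝ) - 1) := by push_cast; ring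
  rw [e2, div_neg, ← neg_div, neg_sub, sub_div]

theorem tendsto_inv_natCast_add_mul_pow {T : ℝ} (hT : 0 < T) {k : ℕ} (hk : k ≠ 0) (c : ℝ) :
    Tendsto (fun N : ℕ => ((((N : ℝ) + c) * T) ^ k)⁻¹) atTop (𝓝 0) :=
  tendsto_inv_atTop_zero.comp ((tendsto_pow_atTop hk).comp
    ((tendsto_atTop_add_const_right _ c tendsto_natCast_atTop_atTop).atTop_mul_const hT))

/-- Termwise the integrals are `w l - w (l + 1)` for `l ≠ 0`; over all of `ℤ` these telescope to zero,
so the total is minus the missing term at `l = 0`. -/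
theorem integral_puncturedLatticeSum {T : ℝ} (hT : 0 < T) {k : ℕ} (hk : 2 ≤ k) (hk2 : Even k) :
    ∫ u in (-(T / 2))..(T / 2), puncturedLatticeSum T k u
      = 2 * (((T / 2) ^ (k - 1))⁻¹ / (k - 1) : ℝ) := by
  have hk1 : Odd (k - 1) := Nat.Even.sub_odd (by omega) hk2 odd_one
  set w : ℤ → ℝ := fun l => (((l - 1 / 2) * T) ^ (k - 1))⁻¹ / (k - 1) with hw
  have hterm : ∀ l : ℤ, ∫ u in (-(T / 2))..(T / 2),
      (if l = 0 then 0 else (((u : ℂ) + l * T) ^ k)⁻¹)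
        = ((w l - w (l + 1) : ℝ) : ℂ) - if l = 0 then ((w 0 - w 1 : ℝ) : ℂ) else 0 := by
    intro l
    by_cases hl : l = 0
    · simp [hl]
    · simp only [hl, if_false, sub_zero]
      have := integral_inv_add_pow hk (a := -(T / 2)) (b := T / 2) (c := l * T) (by
        rw [Set.uIcc_of_le (by linarith)]
        rintro ⟨h1, h2⟩
        rcases lt_or_gt_of_ne hl with h | h
        · have : (l : ℝ) ≤ -1 := by exact_mod_cast Int.le_sub_one_of_lt h
          nlinarith
        · have : (1 : ℝ) ≤ l := by exact_mod_cast h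
          nlinarith)
      push_cast at this
      rw [this, hw]
      push_cast
      ring_nf
  have hsum : HasSum (fun l : ℤ => ∫ u in (-(T / 2))..(T / 2),
      (if l = 0 then 0 else (((u : ℂ) + l * T) ^ k)⁻¹))
      (∫ u in (-(T / 2))..(T / 2), puncturedLatticeSum T k u) := by
    have hnorm : ∀ u ∈ Set.uIoc (-(T / 2)) (T / 2), ‖(u : ℂ)‖ ≤ T / 2 := by
      intro u hu
      rw [Set.uIoc_of_le (by linarith)] at hu
      rw [Complex.norm_real, Real.norm_eq_abs, abs_le]
      exact ⟨hu.1.le, hu.2⟩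
    refine intervalIntegral.hasSum_integral_of_dominated_convergence
      (fun l _ => ((T - T / 2) ^ k)⁻¹ * |1 / (l : ℝ) ^ k|) (fun l => ?_) (fun l => ?_) ?_ ?_ ?_
    · refine Measurable.aestronglyMeasurable ?_
      by_cases hl : l = 0
      · simp [hl]
      · simp only [hl, if_false]
        fun_prop
    · exact Eventually.of_forall fun u hu =>
        norm_puncturedLatticeSum_term_le (by linarith) hT k (hnorm u hu) l
    · exact Eventually.of_forall fun _ _ => summable_puncturedLatticeSum_bound hk _
    · exact intervalIntegrable_const
    · exact Eventually.of_forall fun u hu => (summable_puncturedLatticeSum hT hk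
        ((hnorm u hu).trans_lt (by linarith))).hasSum
  simp only [hterm] at hsum
  have htel := (hsum.add (hasSum_ite_eq (0 : ℤ) ((w 0 - w 1 : ℝ) : ℂ))).comp
    (Finset.tendsto_Ico_neg (R := ℤ))
  have hk1' : k - 1 ≠ 0 := by omega
  have hzero : Tendsto (fun N : ℕ => ((w (-N) - w N : ℝ) : ℂ)) atTop (𝓝 0) := by
    have h1 := (tendsto_inv_natCast_add_mul_pow hT hk1' (1 / 2)).neg.div_const ((k : ℝ) - 1)
    have h2 := (tendsto_inv_natCast_add_mul_pow hT hk1' (-(1 / 2))).div_const ((k : ℝ) - 1)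
    have h3 := (Complex.continuous_ofReal.tendsto _).comp (h1.sub h2)
    simp only [neg_zero, zero_div, sub_zero, Complex.ofReal_zero] at h3
    refine h3.congr fun N => ?_
    have e : (((-(N : ℤ) : ℤ) : ℝ) - 1 / 2) * T = -(((N : ℝ) + 1 / 2) * T) := by
      push_cast
      ring
    simp only [Function.comp, hw, e, hk1.neg_pow, inv_neg, Int.cast_natCast, ← sub_eq_add_neg]
  have hlim := tendsto_nhds_unique htel (hzero.congr fun N => ?_)
  · rw [eq_neg_of_add_eq_zero_left hlim, hw, ← Complex.ofReal_neg]
    have e : ((0 : ℤ) - 1 / 2 : ℝ) * T = -(T / 2) := by push_cast; ring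
    have e' : ((1 : ℤ) - 1 / 2 : ℝ) * T = T / 2 := by push_cast; ring
    simp only [e, e', hk1.neg_pow, inv_neg]
    push_cast
    ring
  · simp only [Function.comp, sub_add_cancel]
    rw [← Complex.ofReal_sum, Finset.sum_Ico_int_sub]

/-- The finite part of the integral of `latticeSum T k` over a period vanishes. The integral over a
period is written as twice that over half a period, `k` being even. -/
theorem tendsto_integral_latticeSum {T : ℝ} (hT : 0 < T) {k : ℕ} (hk : 2 ≤ k) (hk2 : Even k) :
    Tendsto (fun ε : ℝ => 2 * (∫ u in ε..(T / 2), latticeSum T k u)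
      - 2 / (k - 1) * ((ε : ℂ)⁻¹) ^ (k - 1)) (𝓝[>] 0) (𝓝 0) := by
  have hcont : ContinuousOn (fun u : ℝ => puncturedLatticeSum T k u)
      (Set.Icc (-(T / 2)) (T / 2)) := fun u hu =>
    (contDiffAt_puncturedLatticeSum hk (abs_lt.2
      ⟨by linarith [hu.1], by linarith [hu.2]⟩)).continuousAt.continuousWithinAt
  have hint : ∀ a ∈ Set.Icc (-(T / 2)) (T / 2), ∀ b ∈ Set.Icc (-(T / 2)) (T / 2),
      IntervalIntegrable (fun u : ℝ => puncturedLatticeSum T k u) volume a b := fun a ha b hb =>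
    (hcont.mono (Set.uIcc_subset_Icc ha hb)).intervalIntegrable
  have m0 : (0 : ℝ) ∈ Set.Icc (-(T / 2)) (T / 2) := ⟨by linarith, by linarith⟩
  have m1 : T / 2 ∈ Set.Icc (-(T / 2)) (T / 2) := ⟨by linarith, by linarith⟩
  have m2 : -(T / 2) ∈ Set.Icc (-(T / 2)) (T / 2) := ⟨by linarith, by linarith⟩
  have hhalf : 2 * ∫ u in (0 : ℝ)..(T / 2), puncturedLatticeSum T k u
      = 2 * (((T / 2) ^ (k - 1))⁻¹ / (k - 1) : ℝ) := by
    rw [← integral_puncturedLatticeSum hT hk hk2,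
      ← intervalIntegral.integral_add_adjacent_intervals (hint _ m2 _ m0) (hint _ m0 _ m1)]
    have := intervalIntegral.integral_comp_neg (a := 0) (b := T / 2)
      (fun u : ℝ => puncturedLatticeSum T k u)
    simp only [Complex.ofReal_neg, puncturedLatticeSum_neg T hk2, neg_zero] at this
    rw [← this, two_mul]
  have hprim : Tendsto (fun ε : ℝ => ∫ u in ε..(T / 2), puncturedLatticeSum T k u) (𝓝[>] 0)
      (𝓝 (∫ u in (0 : ℝ)..(T / 2), puncturedLatticeSum T k u)) := by
    have h1 := intervalIntegral.continuousOn_primitive_interval_left (μ := volume)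
      (f := fun u : ℝ => puncturedLatticeSum T k u) (a := 0) (b := T / 2)
      ((hcont.mono (Set.uIcc_subset_Icc m0 m1)).integrableOn_uIcc)
    refine (h1 0 Set.left_mem_uIcc).mono_left ?_
    rw [Set.uIcc_of_le (by linarith), ← nhdsWithin_Ioo_eq_nhdsGT (by linarith : (0 : ℝ) < T / 2)]
    exact nhdsWithin_mono _ Set.Ioo_subset_Icc_self
  have hlim := (hprim.const_mul 2).sub_const (2 * (((T / 2) ^ (k - 1))⁻¹ / (k - 1) : ℝ) : ℂ)
  rw [hhalf, sub_self] at hlim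
  refine hlim.congr' ?_
  filter_upwards [Ioo_mem_nhdsGT (by linarith : (0 : ℝ) < T / 2)] with ε hε
  have mε : ε ∈ Set.Icc (-(T / 2)) (T / 2) := ⟨by linarith [hε.1], hε.2.le⟩
  have h0 : (0 : ℝ) ∉ Set.uIcc (ε + 0) (T / 2 + 0) := by
    rw [add_zero, add_zero, Set.uIcc_of_le hε.2.le]
    exact fun h => absurd h.1 (not_le.2 hε.1)
  have e1 : ∫ u in ε..(T / 2), latticeSum T k u
      = ∫ u in ε..(T / 2), ((((u : ℂ) + (0 : ℝ)) ^ k)⁻¹ + puncturedLatticeSum T k u) := by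
    refine intervalIntegral.integral_congr fun u hu => ?_
    rw [Set.uIcc_of_le hε.2.le] at hu
    have := latticeSum_eq_add_punctured hT hk (z := (u : ℂ)) (by
      rw [Complex.norm_real, Real.norm_eq_abs, abs_lt]
      constructor <;> linarith [hu.1, hu.2, hε.1])
    simpa using this
  have hi : IntervalIntegrable (fun u : ℝ => (((u : ℂ) + (0 : ℝ)) ^ k)⁻¹) volume ε (T / 2) := by
    refine ContinuousOn.intervalIntegrable fun u hu => ?_
    refine ContinuousAt.continuousWithinAt (ContinuousAt.inv₀ (by fun_prop) ?_)
    rw [Set.uIcc_of_le hε.2.le] at hu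
    have : 0 < u := hε.1.trans_le hu.1
    rw [Complex.ofReal_zero, add_zero]
    exact pow_ne_zero _ (by exact_mod_cast this.ne')
  rw [e1, intervalIntegral.integral_add hi (hint _ mε _ m1), integral_inv_add_pow hk h0]
  push_cast
  rw [inv_pow]
  ring

/-! ### Subtracting the singular part of a periodic function -/

theorem mem_puncturedLine_of_mem_Ioo {t T u : ℝ} (hu : u ∈ Set.Ioo t (t + T)) :
    u ∈ puncturedLine t T := by
  intro k hk
  have hT : 0 < T := by linarith [hu.1, hu.2]
  rcases le_or_gt k 0 with h | h
  · have : (k : ℝ) ≤ 0 := by exact_mod_cast h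
    nlinarith [hu.1]
  · have : (1 : ℝ) ≤ k := by exact_mod_cast h
    nlinarith [hu.2]

theorem add_mem_puncturedLine_iff {t T u : ℝ} :
    u + T ∈ puncturedLine t T ↔ u ∈ puncturedLine t T := by
  constructor
  · intro h k hk
    exact h (k + 1) (by push_cast; rw [hk]; ring)
  · intro h k hk
    exact h (k - 1) (by push_cast; linarith)

theorem neg_mem_puncturedLine_iff {T u : ℝ} :
    -u ∈ puncturedLine 0 T ↔ u ∈ puncturedLine 0 T := by
  have key : ∀ v : ℝ, v ∈ puncturedLine 0 T → -v ∈ puncturedLine 0 T := fun v h k hk =>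
    h (-k) (by push_cast; linarith)
  exact ⟨fun h => by simpa using key _ h, key u⟩

theorem Function.Periodic.contDiff_of_contDiffAt_Ico {q : ℝ → ℂ} {T : ℝ} {n : WithTop ℕ∞}
    (hq : Function.Periodic q T) (hT : 0 < T) (h : ∀ u ∈ Set.Ico 0 T, ContDiffAt ℝ n q u) :
    ContDiff ℝ n q := by
  rw [contDiff_iff_contDiffAt]
  intro x
  obtain ⟨k, hk, -⟩ := existsUnique_sub_zsmul_mem_Ico hT x 0
  rw [zero_add] at hk
  have e : q = fun y => q (y - k • T) := funext fun y => ((hq.sub_zsmul_eq k)).symm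
  rw [e]
  exact (h _ hk).comp x (contDiffAt_id.sub contDiffAt_const)

theorem contDiffAt_latticeSum {T : ℝ} {k : ℕ} (hk : 2 ≤ k) {u : ℝ} (hu : |u| < T) (hu0 : u ≠ 0) :
    ContDiffAt ℝ ∞ (fun u : ℝ => latticeSum T k u) u := by
  have hT : 0 < T := (abs_nonneg u).trans_lt hu
  have h1 : ContDiffAt ℝ ∞ (fun u : ℝ => ((u : ℂ) ^ k)⁻¹ + puncturedLatticeSum T k u) u := by
    refine ContDiffAt.add (ContDiffAt.inv ?_ (pow_ne_zero _ (by exact_mod_cast hu0)))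
      (contDiffAt_puncturedLatticeSum hk hu)
    exact Complex.ofRealCLM.contDiff.contDiffAt.pow k
  refine h1.congr_of_eventuallyEq ?_
  filter_upwards [continuous_abs.continuousAt.eventually_lt continuousAt_const hu] with v hv
  exact latticeSum_eq_add_punctured hT hk (by rwa [Complex.norm_real, Real.norm_eq_abs])

/-- The even part of a polynomial keeps the even-degree terms. -/
theorem sum_range_two_mul_even_part (c : ℕ → ℂ) (u : ℂ) (r : ℕ) :
    ((∑ k ∈ Finset.range (2 * r), c k * u ^ k) + ∑ k ∈ Finset.range (2 * r), c k * (-u) ^ k) / 2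
      = ∑ i ∈ Finset.range r, c (2 * i) * u ^ (2 * i) := by
  induction r with
  | zero => simp
  | succ r ih =>
    rw [Finset.sum_range_succ, ← ih, mul_add, mul_one, Finset.sum_range_succ,
      Finset.sum_range_succ, Finset.sum_range_succ, Finset.sum_range_succ,
      (even_two_mul r).neg_pow, (odd_two_mul_add_one r).neg_pow]
    ring

/-- The even part of `F`, minus lattice sums matching its singular part at `0`, extends to a smooth
periodic function `q`; `F` behaves like `G u / u ^ (2 * r)` at `0`. -/
theorem exists_regularPart {T : ℝ} (hT : 0 < T) {F : ℝ → ℂ}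
    (hper : ∀ u ∈ puncturedLine 0 T, F (u + T) = F u)
    (hF : ContDiffOn ℝ ∞ F (puncturedLine 0 T)) {G : ℝ → ℂ} (hG : ContDiff ℝ ∞ G) (r : ℕ)
    (hFG : ∀ᶠ u : ℝ in 𝓝[≠] 0, F u = G u / (u : ℂ) ^ (2 * r)) :
    ∃ q : ℝ → ℂ, ContDiff ℝ ∞ q ∧ Function.Periodic q T ∧ Function.Even q ∧
      q 0 = iteratedDeriv (2 * r) G 0 / ((2 * r).factorial : ℂ) -
        ∑ i ∈ Finset.range r, iteratedDeriv (2 * i) G 0 / ((2 * i).factorial : ℂ) *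
          latticeSum T (2 * r - 2 * i) 0 ∧
      ∀ u ∈ Set.Ioo 0 T, q u = (F u + F (-u)) / 2 -
        ∑ i ∈ Finset.range r, iteratedDeriv (2 * i) G 0 / ((2 * i).factorial : ℂ) *
          latticeSum T (2 * r - 2 * i) u := by
  classical
  obtain ⟨H, hH, hH0, hGH⟩ := exists_contDiff_taylor (2 * r) hG
  set c : ℕ → ℂ := fun k => iteratedDeriv k G 0 / (k.factorial : ℂ) with hc
  have hGH : ∀ u : ℝ, G u = ∑ k ∈ Finset.range (2 * r), c k * (u : ℂ) ^ k
      + (u : ℂ) ^ (2 * r) * H u := hGH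
  -- The value `c (2 * r)` on `T ℤ` is the constant term of the even part of `F` at `0`.
  set q : ℝ → ℂ := fun u => (if u ∈ puncturedLine 0 T then (F u + F (-u)) / 2 else c (2 * r)) -
    ∑ i ∈ Finset.range r, c (2 * i) * latticeSum T (2 * r - 2 * i) u with hq
  have hk2 : ∀ i ∈ Finset.range r, 2 ≤ 2 * r - 2 * i := fun i hi => by
    have := Finset.mem_range.1 hi
    omega
  have hIoo : ∀ u ∈ Set.Ioo 0 T, q u = (F u + F (-u)) / 2 -
      ∑ i ∈ Finset.range r, c (2 * i) * latticeSum T (2 * r - 2 * i) u := by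
    intro u hu
    have : u ∈ puncturedLine 0 T := mem_puncturedLine_of_mem_Ioo (by rwa [zero_add])
    simp only [hq, this, if_true]
  have hqper : Function.Periodic q T := by
    intro u
    simp only [hq, add_mem_puncturedLine_iff, Complex.ofReal_add, latticeSum_add_period]
    congr 1
    split_ifs with h
    · rw [hper u h]
      have h' : -(u + T) ∈ puncturedLine 0 T :=
        neg_mem_puncturedLine_iff.2 (add_mem_puncturedLine_iff.2 h)
      have := hper _ h'
      rw [← this]
      congr 3
      ring
    · rfl
  have hqeven : Function.Even q := by
    intro u
    simp only [hq, neg_mem_puncturedLine_iff, Complex.ofReal_neg, neg_neg]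
    rw [add_comm (F (-u))]
    congr 1
    refine Finset.sum_congr rfl fun i _ => ?_
    rw [latticeSum_neg T (by rw [← Nat.mul_sub]; exact even_two_mul _)]
  have hq0 : q 0 = c (2 * r) - ∑ i ∈ Finset.range r, c (2 * i) *
      latticeSum T (2 * r - 2 * i) 0 := by
    have : (0 : ℝ) ∉ puncturedLine 0 T := fun h => h 0 (by simp)
    simp only [hq, this, if_false, Complex.ofReal_zero]
  refine ⟨q, hqper.contDiff_of_contDiffAt_Ico hT fun u hu => ?_, hqper, hqeven, hq0, hIoo⟩
  rcases hu.1.eq_or_lt with rfl | hu0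
  · have hreg : ContDiffAt ℝ ∞ (fun u : ℝ => (H u + H (-u)) / 2 - ∑ i ∈ Finset.range r,
        c (2 * i) * puncturedLatticeSum T (2 * r - 2 * i) u) 0 := by
      refine ContDiffAt.sub ?_ (ContDiffAt.sum fun i hi =>
        contDiffAt_const.mul (contDiffAt_puncturedLatticeSum (hk2 i hi) (by simpa)))
      exact ((hH.add (hH.comp contDiff_neg)).div_const 2).contDiffAt
    refine hreg.congr_of_eventuallyEq ?_
    have hFG' : ∀ᶠ u : ℝ in 𝓝 0, u ≠ 0 → F u = G u / (u : ℂ) ^ (2 * r) :=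
      eventually_nhdsWithin_iff.1 hFG
    have hFGneg : ∀ᶠ u : ℝ in 𝓝 0, -u ≠ 0 → F (-u) = G (-u) / ((-u : ℝ) : ℂ) ^ (2 * r) :=
      (continuous_neg.tendsto' (0 : ℝ) 0 neg_zero).eventually hFG'
    filter_upwards [hFG', hFGneg, Ioo_mem_nhds (neg_lt_zero.2 hT) hT] with v h1 h2 hv
    have hvabs : ‖(v : ℂ)‖ < T := by
      rw [Complex.norm_real, Real.norm_eq_abs]
      exact abs_lt.2 hv
    have hΦ : ∀ i ∈ Finset.range r, c (2 * i) * latticeSum T (2 * r - 2 * i) v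
        = c (2 * i) * ((v : ℂ) ^ (2 * r - 2 * i))⁻¹ +
          c (2 * i) * puncturedLatticeSum T (2 * r - 2 * i) v := fun i hi => by
      rw [latticeSum_eq_add_punctured hT (hk2 i hi) hvabs, mul_add]
    by_cases hv0 : v = 0
    · subst hv0
      rw [hq0, neg_zero, hH0, add_self_div_two, ← Complex.ofReal_zero, Finset.sum_congr rfl hΦ]
      congr 1
      refine Finset.sum_congr rfl fun i hi => ?_
      have : 2 * r - 2 * i ≠ 0 := by have := hk2 i hi; omega
      rw [Complex.ofReal_zero, zero_pow this, inv_zero, mul_zero, zero_add]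
    · have hvC : (v : ℂ) ≠ 0 := by exact_mod_cast hv0
      have hvP : v ∈ puncturedLine 0 T := by
        rcases lt_or_gt_of_ne hv0 with h | h
        · exact neg_mem_puncturedLine_iff.1 (mem_puncturedLine_of_mem_Ioo
            ⟨by linarith, by linarith [hv.1]⟩)
        · exact mem_puncturedLine_of_mem_Ioo ⟨h, by linarith [hv.2]⟩
      have hFe : (F v + F (-v)) / 2 = (∑ i ∈ Finset.range r, c (2 * i) *
          ((v : ℂ) ^ (2 * r - 2 * i))⁻¹) + (H v + H (-v)) / 2 := by
        have hs := sum_range_two_mul_even_part c v r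
        have hs' : ∑ i ∈ Finset.range r, c (2 * i) * ((v : ℂ) ^ (2 * r - 2 * i))⁻¹
            = (∑ i ∈ Finset.range r, c (2 * i) * (v : ℂ) ^ (2 * i)) / (v : ℂ) ^ (2 * r) := by
          rw [Finset.sum_div]
          refine Finset.sum_congr rfl fun i hi => ?_
          have : 2 * i ≤ 2 * r := by have := hk2 i hi; omega
          rw [pow_sub₀ _ hvC this, mul_inv, inv_inv, mul_div_assoc, div_eq_mul_inv]
          ring
        rw [hs', ← hs, h1 hv0, h2 (neg_ne_zero.2 hv0), hGH v, hGH (-v)]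
        have hpow : (v : ℂ) ^ (2 * r) ≠ 0 := pow_ne_zero _ hvC
        rw [Complex.ofReal_neg, (even_two_mul r).neg_pow]
        field_simp
        ring
      simp only [hq, hvP, if_true]
      rw [Finset.sum_congr rfl hΦ, Finset.sum_add_distrib, hFe]
      ring
  · have hn : Set.Ioo 0 T ∈ 𝓝 u := Ioo_mem_nhds hu0 hu.2
    have hsub : Set.Ioo 0 T ⊆ puncturedLine 0 T := fun v hv =>
      mem_puncturedLine_of_mem_Ioo (by rwa [zero_add])
    have h1 : ContDiffAt ℝ ∞ F u := hF.contDiffAt (mem_of_superset hn hsub)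
    have h2 : ContDiffAt ℝ ∞ F (-u) := by
      refine hF.contDiffAt (mem_of_superset
        (Ioo_mem_nhds (neg_lt_neg hu.2) (neg_lt_zero.2 hu0)) fun v hv => ?_)
      exact neg_mem_puncturedLine_iff.1 (hsub ⟨by linarith [hv.2], by linarith [hv.1]⟩)
    have hreg : ContDiffAt ℝ ∞ (fun u : ℝ => (F u + F (-u)) / 2 - ∑ i ∈ Finset.range r,
        c (2 * i) * latticeSum T (2 * r - 2 * i) u) u := by
      refine ContDiffAt.sub ?_ (ContDiffAt.sum fun i hi => contDiffAt_const.mul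
        (contDiffAt_latticeSum (hk2 i hi) (abs_lt.2 ⟨by linarith, hu.2⟩) hu0.ne'))
      exact (h1.add (h2.comp u contDiff_neg.contDiffAt)).div_const 2
    refine hreg.congr_of_eventuallyEq ?_
    filter_upwards [hn] with v hv using hIoo v hv

/-! ### Singularities of even order -/

theorem two_mul_integral_half_period {q : ℝ → ℂ} {T : ℝ} (hc : Continuous q)
    (hper : Function.Periodic q T) (heven : Function.Even q) :
    2 * ∫ u in (0 : ℝ)..(T / 2), q u = ∫ u in (0 : ℝ)..T, q u := by
  have h1 := hper.intervalIntegral_add_eq (-(T / 2)) 0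
  have h2 := intervalIntegral.integral_comp_neg (a := 0) (b := T / 2) q
  simp only [heven _, neg_zero] at h2
  have e : -(T / 2) + T = T / 2 := by ring
  rw [zero_add, e, ← intervalIntegral.integral_add_adjacent_intervals
    (hc.intervalIntegrable _ 0) (hc.intervalIntegrable _ _), ← h2] at h1
  rw [← h1, two_mul]

/-- Lattice sums do not contribute to the finite part. -/
theorem hasFinitePart_of_latticeSum {T : ℝ} (hT : 0 < T) {φ q : ℝ → ℂ} (hc : Continuous q)
    (r : ℕ) (c : ℕ → ℂ) (hφ : ∀ u ∈ Set.Ioo 0 T, φ u = 2 * (q u +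
      ∑ i ∈ Finset.range r, c i * latticeSum T (2 * r - 2 * i) u)) :
    HasFinitePart (fun ε => ∫ u in ε..(T / 2), φ u) (2 * ∫ u in (0 : ℝ)..(T / 2), q u) := by
  have hk2 : ∀ i ∈ Finset.range r, 2 ≤ 2 * r - 2 * i := fun i hi => by
    have := Finset.mem_range.1 hi
    omega
  -- `d i` is the coefficient of `ε ^ (-(2 * r - 2 * i - 1))` in the divergent part.
  set d : ℕ → ℂ := fun i => c i * (2 / ((2 * r - 2 * i : ℕ) - 1)) with hd
  refine ⟨2 * r, fun k => ∑ i ∈ Finset.range r, if 2 * r - 2 * i - 1 = k then d i else 0, 0, ?_⟩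
  have hprim : Tendsto (fun ε : ℝ => ∫ u in ε..(T / 2), q u) (𝓝[>] 0)
      (𝓝 (∫ u in (0 : ℝ)..(T / 2), q u)) := by
    have h1 : Continuous fun ε : ℝ => ∫ u in ε..(T / 2), q u := by
      have e : (fun ε : ℝ => ∫ u in ε..(T / 2), q u) = fun ε : ℝ => -∫ u in (T / 2)..ε, q u :=
        funext fun ε => intervalIntegral.integral_symm _ _
      rw [e]
      exact (intervalIntegral.continuous_primitive
        (fun a b => hc.intervalIntegrable a b) (T / 2)).neg
    exact (h1.tendsto 0).mono_left nhdsWithin_le_nhds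
  have hlim := (hprim.const_mul 2).add (tendsto_finsetSum (Finset.range r) fun i hi =>
    (tendsto_integral_latticeSum hT (hk2 i hi)
      (by rw [← Nat.mul_sub]; exact even_two_mul _)).const_mul (c i))
  simp only [mul_zero, Finset.sum_const_zero, add_zero] at hlim
  refine hlim.congr' ?_
  filter_upwards [Ioo_mem_nhdsGT (by linarith : (0 : ℝ) < T / 2)] with ε hε
  have hpoly : ∑ k ∈ Finset.Icc 1 (2 * r),
      (∑ i ∈ Finset.range r, if 2 * r - 2 * i - 1 = k then d i else 0) * ((ε : ℂ)⁻¹) ^ k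
      = ∑ i ∈ Finset.range r, d i * ((ε : ℂ)⁻¹) ^ (2 * r - 2 * i - 1) := by
    simp only [Finset.sum_mul, ite_mul, zero_mul]
    rw [Finset.sum_comm]
    refine Finset.sum_congr rfl fun i hi => ?_
    rw [Finset.sum_ite_eq, if_pos]
    have := hk2 i hi
    rw [Finset.mem_Icc]
    omega
  have hmem : ∀ u ∈ Set.uIcc ε (T / 2), u ∈ Set.Ioo 0 T := by
    intro u hu
    rw [Set.uIcc_of_le hε.2.le] at hu
    exact ⟨hε.1.trans_le hu.1, by linarith [hu.2]⟩
  have hint : ∀ i ∈ Finset.range r, IntervalIntegrable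
      (fun u : ℝ => c i * latticeSum T (2 * r - 2 * i) u) volume ε (T / 2) := by
    intro i hi
    refine ContinuousOn.intervalIntegrable fun u hu => ContinuousAt.continuousWithinAt ?_
    obtain ⟨h0, h1⟩ := hmem u hu
    exact (contDiffAt_const.mul (contDiffAt_latticeSum (hk2 i hi)
      (abs_lt.2 ⟨by linarith, h1⟩) h0.ne')).continuousAt
  rw [hpoly, intervalIntegral.integral_congr fun u hu => hφ u (hmem u hu),
    intervalIntegral.integral_const_mul,
    intervalIntegral.integral_add (hc.intervalIntegrable _ _)
      (by simpa only [Finset.sum_fn] using IntervalIntegrable.sum _ hint),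
    intervalIntegral.integral_finsetSum hint,
    zero_mul, add_zero, mul_add, add_sub_assoc, Finset.mul_sum, ← Finset.sum_sub_distrib]
  congr 1
  refine Finset.sum_congr rfl fun i _ => ?_
  rw [intervalIntegral.integral_const_mul, hd]
  ring

theorem sum_Ico_even_part (F : ℝ → ℂ) {T : ℝ}
    (hper : ∀ u ∈ puncturedLine 0 T, F (u + T) = F u) (hT : 0 < T) (n : ℕ) :
    ∑ j ∈ Finset.Ico 1 n, (F (j * (T / n)) + F (-(j * (T / n)))) / 2
      = ∑ j ∈ Finset.Ico 1 n, F (j * (T / n)) := by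
  have href : ∑ j ∈ Finset.Ico 1 n, F (-(j * (T / n))) = ∑ j ∈ Finset.Ico 1 n, F (j * (T / n)) := by
    rcases Nat.eq_zero_or_pos n with rfl | hn
    · simp
    have := Finset.sum_Ico_reflect (fun j : ℕ => F (j * (T / n))) 1 (m := n) (n := n) (by omega)
    rw [Nat.add_sub_cancel_left, Nat.add_sub_cancel] at this
    rw [← this]
    refine Finset.sum_congr rfl fun j hj => ?_
    rw [Finset.mem_Ico] at hj
    have hn' : (0 : ℝ) < n := by exact_mod_cast hn
    have hj0 : (0 : ℝ) < j := by exact_mod_cast hj.1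
    have hjn : (j : ℝ) < n := by exact_mod_cast hj.2
    have hmem : (j * (T / n)) ∈ puncturedLine 0 T := by
      refine mem_puncturedLine_of_mem_Ioo ⟨by positivity, ?_⟩
      rw [zero_add, mul_div_assoc', div_lt_iff₀ hn', mul_comm T]
      exact mul_lt_mul_of_pos_right hjn hT
    rw [← hper _ (neg_mem_puncturedLine_iff.2 hmem), Nat.cast_sub hj.2.le]
    congr 1
    field_simp
    ring
  rw [← Finset.sum_div, Finset.sum_add_distrib, href, add_self_div_two]

/-- The expansion for a singularity of even order at the origin, with the truncated integral folded
onto half a period. -/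
theorem even_order_expansion {T : ℝ} (hT : 0 < T) {F : ℝ → ℂ}
    (hper : ∀ u ∈ puncturedLine 0 T, F (u + T) = F u)
    (hF : ContDiffOn ℝ ∞ F (puncturedLine 0 T)) {G : ℝ → ℂ} (hG : ContDiff ℝ ∞ G) (r : ℕ)
    (hFG : ∀ᶠ u : ℝ in 𝓝[≠] 0, F u = G u / (u : ℂ) ^ (2 * r)) :
    ∃ I : ℂ, HasFinitePart (fun ε => ∫ u in ε..(T / 2), (F u + F (-u))) I ∧
      ∀ N : ℕ, (fun n : ℕ => ((T / n : ℝ) : ℂ) * ∑ j ∈ Finset.Ico 1 n, F (j * (T / n)) -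
          (I + 2 * ∑ i ∈ Finset.range (r + 1),
            iteratedDeriv (2 * i) G 0 / ((2 * i).factorial : ℂ) *
              riemannZeta (2 * (r : ℂ) - 2 * (i : ℂ)) *
              ((T / n : ℝ) : ℂ) ^ (-2 * (r : ℤ) + 2 * (i : ℤ) + 1)))
        =O[atTop] (fun n : ℕ => (T / n : ℝ) ^ N) := by
  obtain ⟨q, hq, hqper, hqeven, hq0, hqF⟩ := exists_regularPart hT hper hF hG r hFG
  have hk2 : ∀ i ∈ Finset.range r, 2 ≤ 2 * r - 2 * i := fun i hi => by
    have := Finset.mem_range.1 hi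
    omega
  set c : ℕ → ℂ := fun k => iteratedDeriv k G 0 / (k.factorial : ℂ) with hc
  refine ⟨∫ u in (0 : ℝ)..T, q u, ?_, fun N => ?_⟩
  · rw [← two_mul_integral_half_period hq.continuous hqper hqeven]
    refine hasFinitePart_of_latticeSum hT hq.continuous r (fun i => c (2 * i)) fun u hu => ?_
    rw [hqF u hu]
    ring
  · obtain ⟨C, hC⟩ := norm_trapezoid_sub_integral_le hT N q hq hqper
    refine IsBigO.of_bound C ?_
    filter_upwards [eventually_ge_atTop 1] with n hn
    have hn' : (0 : ℝ) < n := by exact_mod_cast hn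
    rw [Real.norm_of_nonneg (by positivity)]
    refine (le_of_eq ?_).trans (hC n hn 0)
    congr 1
    have hsumq : ∑ j ∈ Finset.range n, q (0 + j * (T / n)) = c (2 * r) +
        ∑ j ∈ Finset.Ico 1 n, F (j * (T / n)) - ∑ i ∈ Finset.range r,
          c (2 * i) * (2 * riemannZeta (2 * r - 2 * i : ℕ) *
            (((T / n : ℝ) : ℂ) ^ (2 * r - 2 * i))⁻¹) := by
      have hsplit : ∀ p : ℕ → ℂ, ∑ j ∈ Finset.range n, p j = p 0 + ∑ j ∈ Finset.Ico 1 n, p j := by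
        intro p
        rw [Finset.range_eq_Ico, Finset.sum_eq_sum_Ico_succ_bot (by omega)]
      have hIco : ∀ j ∈ Finset.Ico 1 n, q (0 + j * (T / n)) =
          (F (j * (T / n)) + F (-(j * (T / n)))) / 2 - ∑ i ∈ Finset.range r, c (2 * i) *
            latticeSum T (2 * r - 2 * i) ((j * (T / n) : ℝ) : ℂ) := by
        intro j hj
        rw [Finset.mem_Ico] at hj
        have hj0 : (0 : ℝ) < j := by exact_mod_cast hj.1
        have hjn : (j : ℝ) < n := by exact_mod_cast hj.2
        rw [zero_add, hqF _ ⟨by positivity, ?_⟩]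
        rw [mul_div_assoc', div_lt_iff₀ hn', mul_comm T]
        exact mul_lt_mul_of_pos_right hjn hT
      rw [hsplit, Finset.sum_congr rfl hIco, Finset.sum_sub_distrib, sum_Ico_even_part F hper hT,
        Finset.sum_comm]
      have hΦ : ∑ i ∈ Finset.range r, c (2 * i) * (2 * riemannZeta (2 * r - 2 * i : ℕ) *
            (((T / n : ℝ) : ℂ) ^ (2 * r - 2 * i))⁻¹)
          = (∑ i ∈ Finset.range r, c (2 * i) * latticeSum T (2 * r - 2 * i) 0) +
            ∑ i ∈ Finset.range r, ∑ j ∈ Finset.Ico 1 n, c (2 * i) *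
              latticeSum T (2 * r - 2 * i) ((j * (T / n) : ℝ) : ℂ) := by
        rw [← Finset.sum_add_distrib]
        refine Finset.sum_congr rfl fun i hi => ?_
        rw [← sum_latticeSum T (hk2 i hi) (by rw [← Nat.mul_sub]; exact even_two_mul _) hn,
          hsplit, mul_add, Finset.mul_sum]
        simp
      rw [hΦ, Nat.cast_zero, zero_mul, add_zero, hq0]
      ring
    have hh : ((T / n : ℝ) : ℂ) ≠ 0 := by
      have : (0 : ℝ) < T / n := by positivity
      exact_mod_cast this.ne'
    have hterm : ∀ i ∈ Finset.range r, ((T / n : ℝ) : ℂ) * (c (2 * i) *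
        (2 * riemannZeta (2 * r - 2 * i : ℕ) * (((T / n : ℝ) : ℂ) ^ (2 * r - 2 * i))⁻¹))
        = 2 * (c (2 * i) * riemannZeta (2 * (r : ℂ) - 2 * (i : ℂ)) *
          ((T / n : ℝ) : ℂ) ^ (-2 * (r : ℤ) + 2 * (i : ℤ) + 1)) := by
      intro i hi
      have hle : 2 * i ≤ 2 * r := by have := hk2 i hi; omega
      have e : -2 * (r : ℤ) + 2 * (i : ℤ) + 1 = -((2 * r - 2 * i : ℕ) : ℤ) + 1 := by
        rw [Nat.cast_sub hle]
        push_cast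
        ring
      rw [e, zpow_add₀ hh, zpow_one, zpow_neg, zpow_natCast, Nat.cast_sub hle]
      push_cast
      ring
    have hsum : ((T / n : ℝ) : ℂ) * ∑ i ∈ Finset.range r, c (2 * i) *
        (2 * riemannZeta (2 * r - 2 * i : ℕ) * (((T / n : ℝ) : ℂ) ^ (2 * r - 2 * i))⁻¹)
        = 2 * ∑ i ∈ Finset.range r, c (2 * i) * riemannZeta (2 * (r : ℂ) - 2 * (i : ℂ)) *
          ((T / n : ℝ) : ℂ) ^ (-2 * (r : ℤ) + 2 * (i : ℤ) + 1) := by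
      rw [Finset.mul_sum, Finset.sum_congr rfl hterm, ← Finset.mul_sum]
    rw [hsumq, Finset.sum_range_succ, mul_sub, hsum]
    have e0 : -2 * (r : ℤ) + 2 * (r : ℤ) + 1 = 1 := by ring
    rw [e0, zpow_one, sub_self, riemannZeta_zero]
    simp only [hc]
    ring

/-! ### Finite parts over a period and the general case -/

/-- By periodicity the integral over `[a, b]` minus a neighbourhood of `t` equals that over the period
centred at `t`, which is folded onto `[ε, T / 2]` by `u ↦ -u`. -/
theorem isHadamardFinitePart_of_hasFinitePart {f : ℝ → ℂ} {a b t T : ℝ} (hat : a < t)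
    (htb : t < b) (hT : T = b - a) (hper : ∀ x ∈ puncturedLine t T, f (x + T) = f x)
    (hf : ContinuousOn f (puncturedLine t T)) {I : ℂ}
    (hI : HasFinitePart (fun ε => ∫ u in ε..(T / 2), (f (t + u) + f (t + -u))) I) :
    IsHadamardFinitePart f a t b I := by
  have hright : Set.Ioo t (t + T) ⊆ puncturedLine t T := fun x hx =>
    mem_puncturedLine_of_mem_Ioo hx
  have hleft : Set.Ioo (t - T) t ⊆ puncturedLine t T := fun x hx =>
    add_mem_puncturedLine_iff.1 (hright ⟨by linarith [hx.1], by linarith [hx.2]⟩)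
  have hiR : ∀ x ∈ Set.Ioo t (t + T), ∀ y ∈ Set.Ioo t (t + T), IntervalIntegrable f volume x y :=
    fun x hx y hy => (hf.mono
      ((Set.OrdConnected.uIcc_subset Set.ordConnected_Ioo hx hy).trans hright)).intervalIntegrable
  have hiL : ∀ x ∈ Set.Ioo (t - T) t, ∀ y ∈ Set.Ioo (t - T) t, IntervalIntegrable f volume x y :=
    fun x hx y hy => (hf.mono
      ((Set.OrdConnected.uIcc_subset Set.ordConnected_Ioo hx hy).trans hleft)).intervalIntegrable
  have ma : a ∈ Set.Ioo (t - T) t := ⟨by linarith, hat⟩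
  have mb : b ∈ Set.Ioo t (t + T) := ⟨htb, by linarith⟩
  have mL : t - T / 2 ∈ Set.Ioo (t - T) t := ⟨by linarith, by linarith⟩
  have mR : t + T / 2 ∈ Set.Ioo t (t + T) := ⟨by linarith, by linarith⟩
  have hsmall : ∀ᶠ ε : ℝ in 𝓝[>] 0, t - ε ∈ Set.Ioo (t - T) t ∧ t + ε ∈ Set.Ioo t (t + T) := by
    filter_upwards [Ioo_mem_nhdsGT (by linarith : (0 : ℝ) < T)] with ε hε
    exact ⟨⟨by linarith [hε.2], by linarith [hε.1]⟩, ⟨by linarith [hε.1], by linarith [hε.2]⟩⟩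
  refine ⟨?_, ?_⟩
  · filter_upwards [hsmall] with ε hε
    exact ⟨hiL _ ma _ hε.1, hiR _ hε.2 _ mb⟩
  · obtain ⟨N, c, d, h⟩ := hI
    refine ⟨N, c, d, h.congr' ?_⟩
    filter_upwards [hsmall] with ε hε
    congr 1
    -- Periodicity moves the piece of `[a, b]` lying outside the centred period to the other side.
    have hwrap : ∫ x in a..(t - T / 2), f x = ∫ x in b..(t + T / 2), f x := by
      have h1 := intervalIntegral.integral_comp_add_right (a := a) (b := t - T / 2) f T
      have e1 : a + T = b := by linarith
      have e2 : t - T / 2 + T = t + T / 2 := by ring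
      rw [e1, e2] at h1
      rw [← h1]
      refine intervalIntegral.integral_congr fun x hx => (hper x (hleft ?_)).symm
      exact Set.OrdConnected.uIcc_subset Set.ordConnected_Ioo ma mL hx
    have hplus := intervalIntegral.integral_comp_add_left (a := ε) (b := T / 2) f t
    have hminus := intervalIntegral.integral_comp_sub_left (a := ε) (b := T / 2) f t
    have hiplus : IntervalIntegrable (fun u => f (t + u)) volume ε (T / 2) := by
      have := (hiR _ hε.2 _ mR).comp_add_left t
      simpa using this
    have himinus : IntervalIntegrable (fun u => f (t - u)) volume ε (T / 2) := by
      have := (hiL _ hε.1 _ mL).comp_sub_left t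
      simpa using this
    simp only [← sub_eq_add_neg]
    rw [intervalIntegral.integral_add hiplus himinus, hplus, hminus,
      ← intervalIntegral.integral_add_adjacent_intervals (hiL _ ma _ mL) (hiL _ mL _ hε.1),
      ← intervalIntegral.integral_add_adjacent_intervals (hiR _ hε.2 _ mR) (hiR _ mR _ mb),
      hwrap, intervalIntegral.integral_symm b]
    ring

theorem isLittleO_rpow_of_isBigO_pow {E : Type*} [NormedAddCommGroup E] {T : ℝ} (hT : 0 < T)
    {e : ℕ → E} (he : ∀ N : ℕ, e =O[atTop] fun n : ℕ => (T / n : ℝ) ^ N) (μ : ℝ) :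
    e =o[atTop] fun n : ℕ => (T / n : ℝ) ^ μ := by
  obtain ⟨N, hN⟩ := exists_nat_gt μ
  refine (he N).trans_isLittleO ?_
  have h0 : Tendsto (fun n : ℕ => T / n) atTop (𝓝[>] 0) := by
    refine tendsto_nhdsWithin_iff.2 ⟨tendsto_const_div_atTop_nhds_zero_nat T, ?_⟩
    filter_upwards [eventually_gt_atTop 0] with n hn
    have : (0 : ℝ) < n := by exact_mod_cast hn
    exact div_pos hT this
  have h1 : (fun x : ℝ => x ^ (N : ℝ)) =o[𝓝[>] 0] fun x : ℝ => x ^ μ := by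
    rw [isLittleO_iff_tendsto']
    · have h2 : Tendsto (fun x : ℝ => x ^ ((N : ℝ) - μ)) (𝓝[>] 0) (𝓝 0) := by
        have := (Real.continuousAt_rpow_const 0 ((N : ℝ) - μ) (Or.inr (by linarith))).tendsto
        rw [Real.zero_rpow (by linarith)] at this
        exact this.mono_left nhdsWithin_le_nhds
      refine h2.congr' ?_
      filter_upwards [self_mem_nhdsWithin] with x hx
      rw [Real.rpow_sub hx]
    · filter_upwards [self_mem_nhdsWithin] with x hx h
      exact absurd h (Real.rpow_pos_of_pos hx μ).ne'
  simpa only [Function.comp_def, Real.rpow_natCast] using h1.comp_tendsto h0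

/-- The expansion for a singularity of even order at `t`, for `g` expressed in the variable
`u = x - t` and smooth on the whole line. -/
theorem singular_periodic_expansion {a b t T : ℝ} (hat : a < t) (htb : t < b) (hT : T = b - a)
    {f g : ℝ → ℂ} (hper : ∀ x ∈ puncturedLine t T, f (x + T) = f x)
    (hf : ContDiffOn ℝ ∞ f (puncturedLine t T)) (hg : ContDiff ℝ ∞ g) (r : ℕ)
    (hfg : ∀ᶠ u : ℝ in 𝓝[≠] 0, f (t + u) = g u / (u : ℂ) ^ (2 * r)) :
    IsHadamardFinitePart f a t b (hadamardFinitePart f a t b) ∧ ∀ μ : ℝ,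
      (fun n : ℕ => trapezoidalSum f t T n - (hadamardFinitePart f a t b +
        2 * ∑ i ∈ Finset.range (r + 1), iteratedDeriv (2 * i) g 0 / ((2 * i).factorial : ℂ) *
          riemannZeta (2 * (r : ℂ) - 2 * (i : ℂ)) *
            ((T / n : ℝ) : ℂ) ^ (-2 * (r : ℤ) + 2 * (i : ℤ) + 1)))
        =o[atTop] (fun n : ℕ => (T / n : ℝ) ^ μ) := by
  have hmem : ∀ u : ℝ, t + u ∈ puncturedLine t T ↔ u ∈ puncturedLine 0 T := fun u =>
    forall_congr' fun k => by rw [zero_add, Ne, Ne, add_right_inj]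
  have hperF : ∀ u ∈ puncturedLine 0 T, f (t + (u + T)) = f (t + u) := fun u hu => by
    rw [← add_assoc]
    exact hper _ ((hmem u).2 hu)
  have hF : ContDiffOn ℝ ∞ (fun u => f (t + u)) (puncturedLine 0 T) :=
    hf.comp (contDiff_const.add contDiff_id).contDiffOn fun u hu => (hmem u).2 hu
  obtain ⟨I, hI, hexp⟩ := even_order_expansion (by linarith) hperF hF hg r hfg
  have hH := isHadamardFinitePart_of_hasFinitePart hat htb hT hper hf.continuousOn hI
  have hspec : IsHadamardFinitePart f a t b (hadamardFinitePart f a t b) := by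
    rw [hadamardFinitePart, dif_pos ⟨I, hH⟩]
    exact Exists.choose_spec (⟨I, hH⟩ : ∃ J, IsHadamardFinitePart f a t b J)
  refine ⟨hspec, fun μ => ?_⟩
  rw [hspec.unique hH]
  exact isLittleO_rpow_of_isBigO_pow (by linarith) hexp μ

theorem theorem3p1 (a b t T : ℝ) (hat : a < t) (htb : t < b) (hT : T = b - a)
    (m : ℕ) (hm : 1 ≤ m) (f g : ℝ → ℂ)
    (hg : ContDiffOn ℝ ∞ g (Set.Icc a b))
    (hfg : ∀ x ∈ Set.Icc a b, x ≠ t → f x = g x / ((x : ℂ) - (t : ℂ)) ^ m)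
    (hper : ∀ x ∈ puncturedLine t T, f (x + T) = f x)
    (hf : ContDiffOn ℝ ∞ f (puncturedLine t T)) :
    IsHadamardFinitePart f a t b (hadamardFinitePart f a t b) ∧
    (∀ r : ℕ, m = 2 * r → ∀ μ : ℝ, 0 < μ →
      (fun n : ℕ => trapezoidalSum f t T n -
          (hadamardFinitePart f a t b +
            2 * ∑ i ∈ Finset.range (r + 1),
              iteratedDeriv (2 * i) g t / ((2 * i).factorial : ℂ) *
                riemannZeta (2 * (r : ℂ) - 2 * (i : ℂ)) *
                ((T / n : ℝ) : ℂ) ^ (-2 * (r : ℤ) + 2 * (i : ℤ) + 1)))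
        =o[atTop] (fun n : ℕ => (T / n : ℝ) ^ μ)) ∧
    (∀ r : ℕ, m = 2 * r + 1 → ∀ μ : ℝ, 0 < μ →
      (fun n : ℕ => trapezoidalSum f t T n -
          (hadamardFinitePart f a t b +
            2 * ∑ i ∈ Finset.range (r + 1),
              iteratedDeriv (2 * i + 1) g t / ((2 * i + 1).factorial : ℂ) *
                riemannZeta (2 * (r : ℂ) - 2 * (i : ℂ)) *
                ((T / n : ℝ) : ℂ) ^ (-2 * (r : ℤ) + 2 * (i : ℤ) + 1)))
        =o[atTop] (fun n : ℕ => (T / n : ℝ) ^ μ)) := by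
  obtain ⟨G₀, hG₀, hG₀g⟩ := exists_contDiff_eventuallyEq (Icc_mem_nhds hat htb) hg
  set G : ℝ → ℂ := fun u => G₀ (t + u) with hGdef
  have hG : ContDiff ℝ ∞ G := hG₀.comp (contDiff_const.add contDiff_id)
  have hderiv : ∀ k, iteratedDeriv k G 0 = iteratedDeriv k g t := fun k => by
    rw [hGdef, iteratedDeriv_comp_const_add, ← hG₀g.iteratedDeriv_eq]
    simp only [add_zero]
  have htend : Tendsto (fun u : ℝ => t + u) (𝓝 0) (𝓝 t) :=
    (continuous_const.add continuous_id).tendsto' _ _ (add_zero t)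
  have hfG : ∀ᶠ u : ℝ in 𝓝[≠] 0, f (t + u) = G u / (u : ℂ) ^ m := by
    filter_upwards [(htend.eventually hG₀g).filter_mono nhdsWithin_le_nhds,
      (htend.eventually (Icc_mem_nhds hat htb)).filter_mono nhdsWithin_le_nhds,
      self_mem_nhdsWithin] with u hu hmem hu0
    rw [hfg _ hmem (by simpa using hu0), Complex.ofReal_add, add_sub_cancel_left, ← hu]
  rcases Nat.even_or_odd' m with ⟨r, rfl | rfl⟩
  · obtain ⟨hfp, hexp⟩ := singular_periodic_expansion hat htb hT hper hf hG r hfG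
    refine ⟨hfp, fun s hs μ _ => ?_, fun s hs => by omega⟩
    obtain rfl : r = s := by omega
    simpa only [hderiv] using hexp μ
  · have hfG' : ∀ᶠ u : ℝ in 𝓝[≠] 0,
        f (t + u) = (u * G u) / (u : ℂ) ^ (2 * (r + 1)) := by
      filter_upwards [hfG, self_mem_nhdsWithin] with u hu hu0
      have hu0' : (u : ℂ) ≠ 0 := by exact_mod_cast hu0
      rw [hu, show 2 * (r + 1) = 2 * r + 1 + 1 by ring, pow_succ' _ (2 * r + 1),
        mul_div_mul_left _ _ hu0']
    obtain ⟨hfp, hexp⟩ := singular_periodic_expansion hat htb hT hper hf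
      (Complex.ofRealCLM.contDiff.mul hG) (r + 1) hfG'
    refine ⟨hfp, fun s hs => by omega, fun s hs μ _ => ?_⟩
    obtain rfl : r = s := by omega
    refine (hexp μ).congr_left fun n => ?_
    congr 3
    -- The term `i = 0` vanishes because `u * G u` is zero at `0`; the others are shifted by one.
    rw [Finset.sum_range_succ']
    have h0 : iteratedDeriv (2 * 0) (fun u : ℝ => Complex.ofRealCLM u * G u) 0 = 0 := by simp
    rw [h0, zero_div, zero_mul, zero_mul, add_zero]
    refine Finset.sum_congr rfl fun i _ => ?_
    have hcoef := iteratedDeriv_succ_ofReal_mul_div_factorial hG (2 * i + 1)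
    rw [hderiv] at hcoef
    congr 1
    · rw [← hcoef]
      congr 2
      push_cast
      ring
    · congr 1
      push_cast
      ring
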